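/- **Syntax of RMPC.** Let $\mathcal A$ be a set of actions, $\mathcal K$ a set of communication keys (both countable in the intended use; any sets will do), and let rates range over $\mathbb R_{>0}$. Standard forward processes $P,Q$ and reversible processes $R,S$ are generated by $$P,Q ::= \underline{0}\mid \langle a,\lambda\rangle.P\mid P+Q\mid P\parallel_L Q,\qquad R,S ::= P\mid \langle a,\lambda\rangle[i].R\mid R+S\mid R\parallel_L S,$$ with $a\in\mathcal A$, $\lambda\in\mathbb R_{>0}$, $i\in\mathcal K$, $L\subseteq\mathcal A$. Write $\mathrm{std}(R)$ if $R$ is a standard forward process, and $\mathrm{key}(R)$ for the set of keys occurring in $R$. **Semantics.** Let $\lambda\mapsto\overline\lambda$ be any function $\mathbb R_{>0}\to\mathbb R_{>0}$ (the backward rates). The forward transition relation $\to$ is the least relation with, for labels $\langle a,\lambda\rangle[i]$: (Act1) $\langle a,\lambda\rangle.R\xrightarrow{\langle a,\lambda\rangle[i]}\langle a,\lambda\rangle[i].R$ if $\mathrm{std}(R)$; (Act2) if $R\xrightarrow{\langle b,\mu\rangle[j]}R'$ and $j\ne i$, then $\langle a,\lambda\rangle[i].R\xrightarrow{\langle b,\mu\rangle[j]}\langle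 a,\lambda\rangle[i].R'$; (Cho) if $R\xrightarrow{\ell}R'$ and $\mathrm{std}(S)$, then $R+S\xrightarrow{\ell}R'+S$, and symmetrically; (Par) if $R\xrightarrow{\langle a,\lambda\rangle[i]}R'$, $a\notin L$ and $i\notin\mathrm{key}(S)$, then $R\parallel_L S\xrightarrow{\langle a,\lambda\rangle[i]}R'\parallel_L S$, and symmetrically; (Coo) if $R\xrightarrow{\langle a,\lambda\rangle[i]}R'$, $S\xrightarrow{\langle a,\mu\rangle[i]}S'$ and $a\in L$, then $R\parallel_L S\xrightarrow{\langle a,\lambda\mu\rangle[i]}R'\parallel_L S'$. The backward transition relation $\dashrightarrow$ is the least relation that satisfies the same rules, except that (Act1) is replaced by $\langle a,\lambda\rangle[i].R\overset{\langle a,\overline\lambda\rangle[i]}{\dashrightarrow}\langle a,\lambda\rangle.R$ if $\mathrm{std}(R)$; in particular the rate of a backward cooperation is the product of the two backward rates. Forward and backward labels are considered different. A process is *reachable* if it is obtained from a standard forward process by finitely many forward transitions. **Computations.** A transition $\theta$ is a forward or backward transition between reachable processes, with a source, a label and a target. For a forward transition $\theta$ from $R$ to $S$, its inverse $\overline\theta$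 is the backward transition from $S$ to $R$ with the same action and key (with the rate given by the backward rules). A computation is a finite sequence of composable transitions; there is an empty computation $\varepsilon_R$ at every reachable $R$. Transitions or computations are coinitial if they have the same source and cofinal if they have the same target. **Concurrency.** The causal set $\mathrm{cau}(R,i)$ is defined by $\mathrm{cau}(P,i)=\emptyset$ for standard $P$; $\mathrm{cau}(\langle a,\lambda\rangle[j].R,i)=\emptyset$ if $j=i$ or $i\notin\mathrm{key}(R)$, and $\{j\}\cup\mathrm{cau}(R,i)$ otherwise; $\mathrm{cau}(R+S,i)=\mathrm{cau}(R\parallel_L S,i)=\mathrm{cau}(R,i)\cup\mathrm{cau}(S,i)$. Contexts are $\mathcal C ::= \bullet\mid\langle a,\lambda\rangle[i].\mathcal C\mid R+\mathcal C\mid\mathcal C+R\mid R\parallel_L\mathcal C\mid\mathcal C\parallel_L R$. Two coinitial transitions from $R$ are *in conflict* if, up to exchanging them, either (1) the first is a forward transition with key $i$ and target $S_1$, the second is a backward transition with key $j$, and $j\in\mathrm{cau}(S_1,i)$; or (2) both are forward, $R=\mathcal C[P_1+P_2]$ for a context $\mathcal C$ and standard $P_1,P_2$, and the $k$-th transition is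 derived from a forward transition of $P_k$ at that place, $k=1,2$. Coinitial transitions that are not in conflict are *concurrent*. **Causal equivalence** $\asymp$ is the least equivalence relation on computations that is closed under composition and satisfies: $\theta_1\theta_2'\asymp\theta_2\theta_1'$ whenever $\theta_1,\theta_2$ are coinitial and concurrent, $\theta_2'$ is composable with $\theta_1$ and has the label of $\theta_2$, $\theta_1'$ is composable with $\theta_2$ and has the label of $\theta_1$, and $\theta_1',\theta_2'$ are cofinal; and $\theta\overline\theta\asymp\varepsilon$, $\overline\theta\theta\asymp\varepsilon$ for every forward transition $\theta$, with $\varepsilon$ at the respective source. **Theorem (causal consistency).** For all computations $\omega_1,\omega_2$ of RMPC, $\omega_1\asymp\omega_2$ if and only if $\omega_1$ and $\omega_2$ are coinitial and cofinal. Moreover: (i) if $P$ is a standard forward process and a process $S$ is reached from $P$ by finitely many forward and backward transitions, then $S$ is reached from $P$ by finitely many forward transitions; (ii) any two distinct coinitial backward transitions $\theta_1,\theta_2$ are concurrent, and there are cofinal transitions $\theta_1',\theta_2'$ with the labels of $\theta_1,\theta_2$ respectively, composable with $\theta_2,\theta_1$ respectively, such that $\theta_1\theta_2'\asymp\theta_2\theta_1'$.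 -/

import Mathlib

namespace RMPC

universe u v

/-- Rates are the positive reals. -/
abbrev Rate : Type := {x : ℝ // 0 < x}

/-- Raw terms: the terminated process, the prefix `<a, r> . P`, the executed prefix
`<a, r>[i] . R`, the choice `R + S`, and the parallel composition of `R` and `S` that
synchronizes on the actions of the set `L`. -/
inductive Term (Act : Type u) (Key : Type v) : Type (max u v)
  | nil : Term Act Key
  | pre (a : Act) (r : Rate) (P : Term Act Key) : Term Act Key
  | done (a : Act) (r : Rate) (i : Key) (R : Term Act Key) : Term Act Key
  | cho (R S : Term Act Key) : Term Act Key
  | par (L : Set Act) (R S : Term Act Key) : Term Act Key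

variable {Act : Type u} {Key : Type v}

/-- `Std P`: the term `P` is generated by the grammar of standard forward processes. -/
inductive Std : Term Act Key → Prop
  | nil : Std .nil
  | pre (a : Act) (r : Rate) {P : Term Act Key} : Std P → Std (.pre a r P)
  | cho {P Q : Term Act Key} : Std P → Std Q → Std (.cho P Q)
  | par (L : Set Act) {P Q : Term Act Key} : Std P → Std Q → Std (.par L P Q)

/-- `IsProc R`: the term `R` is generated by the grammar of reversible processes (an executed
prefix never occurs below an unexecuted one). -/
inductive IsProc : Term Act Key → Prop
  | std {P : Term Act Key} : Std P → IsProc P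
  | done (a : Act) (r : Rate) (i : Key) {R : Term Act Key} : IsProc R → IsProc (.done a r i R)
  | cho {R S : Term Act Key} : IsProc R → IsProc S → IsProc (.cho R S)
  | par (L : Set Act) {R S : Term Act Key} : IsProc R → IsProc S → IsProc (.par L R S)

/-- The keys that occur in a process. (Below an unexecuted prefix of a process there are none.) -/
def keys : Term Act Key → Set Key
  | .nil => ∅
  | .pre _ _ _ => ∅
  | .done _ _ i R => {i} ∪ keys R
  | .cho R S => keys R ∪ keys S
  | .par _ R S => keys R ∪ keys S

open Classical in
/-- The causal set of a process until the key `i`. -/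
noncomputable def cau : Term Act Key → Key → Set Key
  | .nil, _ => ∅
  | .pre _ _ _, _ => ∅
  | .done _ _ j R, i => if j = i ∨ i ∉ keys R then ∅ else {j} ∪ cau R i
  | .cho R S, i => cau R i ∪ cau S i
  | .par _ R S, i => cau R i ∪ cau S i

/-- Transition labels `<a, r>[i]`. -/
@[ext]
structure Label (Act : Type u) (Key : Type v) where
  act : Act
  rate : Rate
  key : Key

/-- `Fwd R l R'`: the forward transition from `R` to `R'` with label `l`. -/
inductive Fwd : Term Act Key → Label Act Key → Term Act Key → Prop
  | act₁ (a : Act) (r : Rate) (i : Key) {R : Term Act Key} :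
      Std R → Fwd (.pre a r R) ⟨a, r, i⟩ (.done a r i R)
  | act₂ (a : Act) (r : Rate) (i : Key) {R R' : Term Act Key} {l : Label Act Key} :
      Fwd R l R' → l.key ≠ i → Fwd (.done a r i R) l (.done a r i R')
  | choL {R R' S : Term Act Key} {l : Label Act Key} :
      Fwd R l R' → Std S → Fwd (.cho R S) l (.cho R' S)
  | choR {R S S' : Term Act Key} {l : Label Act Key} :
      Fwd S l S' → Std R → Fwd (.cho R S) l (.cho R S')
  | parL {L : Set Act} {R R' S : Term Act Key} {l : Label Act Key} :
      Fwd R l R' → l.act ∉ L → l.key ∉ keys S → Fwd (.par L R S) l (.par L R' S)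
  | parR {L : Set Act} {R S S' : Term Act Key} {l : Label Act Key} :
      Fwd S l S' → l.act ∉ L → l.key ∉ keys R → Fwd (.par L R S) l (.par L R S')
  | coo {L : Set Act} {R R' S S' : Term Act Key} {a : Act} {r s : Rate} {i : Key} :
      Fwd R ⟨a, r, i⟩ R' → Fwd S ⟨a, s, i⟩ S' → a ∈ L →
        Fwd (.par L R S) ⟨a, r * s, i⟩ (.par L R' S')

/-- `Bwd bar R l R'`: the backward transition from `R` to `R'` with label `l`, where `bar r` is
the (arbitrary) backward rate of an action with rate `r`. -/
inductive Bwd (bar : Rate → Rate) : Term Act Key → Label Act Key → Term Act Key → Prop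
  | act₁ (a : Act) (r : Rate) (i : Key) {R : Term Act Key} :
      Std R → Bwd bar (.done a r i R) ⟨a, bar r, i⟩ (.pre a r R)
  | act₂ (a : Act) (r : Rate) (i : Key) {R R' : Term Act Key} {l : Label Act Key} :
      Bwd bar R l R' → l.key ≠ i → Bwd bar (.done a r i R) l (.done a r i R')
  | choL {R R' S : Term Act Key} {l : Label Act Key} :
      Bwd bar R l R' → Std S → Bwd bar (.cho R S) l (.cho R' S)
  | choR {R S S' : Term Act Key} {l : Label Act Key} :
      Bwd bar S l S' → Std R → Bwd bar (.cho R S) l (.cho R S')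
  | parL {L : Set Act} {R R' S : Term Act Key} {l : Label Act Key} :
      Bwd bar R l R' → l.act ∉ L → l.key ∉ keys S → Bwd bar (.par L R S) l (.par L R' S)
  | parR {L : Set Act} {R S S' : Term Act Key} {l : Label Act Key} :
      Bwd bar S l S' → l.act ∉ L → l.key ∉ keys R → Bwd bar (.par L R S) l (.par L R S')
  | coo {L : Set Act} {R R' S S' : Term Act Key} {a : Act} {r s : Rate} {i : Key} :
      Bwd bar R ⟨a, r, i⟩ R' → Bwd bar S ⟨a, s, i⟩ S' → a ∈ L →
        Bwd bar (.par L R S) ⟨a, r * s, i⟩ (.par L R' S')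

/-- There is a forward transition from `R` to `S`. -/
def FwdStep (R S : Term Act Key) : Prop := ∃ l, Fwd R l S

/-- There is a backward transition from `R` to `S`. -/
def BwdStep (bar : Rate → Rate) (R S : Term Act Key) : Prop := ∃ l, Bwd bar R l S

/-- Reachable processes: those obtained from a standard forward process by finitely many forward
transitions. -/
def Reachable (R : Term Act Key) : Prop := ∃ P, Std P ∧ Relation.ReflTransGen FwdStep P R

theorem Fwd.isProc {R S : Term Act Key} {l : Label Act Key} (h : Fwd R l S) :
    IsProc R → IsProc S := by
  induction h with
  | act₁ a r i hR => exact fun _ => .done a r i (.std hR)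
  | act₂ a r i _ _ ih =>
    intro h
    cases h with
    | std h => cases h
    | done _ _ _ h => exact .done a r i (ih h)
  | choL _ _ ih =>
    rintro (⟨_ | _ | ⟨h1, h2⟩⟩ | _ | ⟨h1, h2⟩)
    · exact .cho (ih (.std h1)) (.std h2)
    · exact .cho (ih h1) h2
  | choR _ _ ih =>
    rintro (⟨_ | _ | ⟨h1, h2⟩⟩ | _ | ⟨h1, h2⟩)
    · exact .cho (.std h1) (ih (.std h2))
    · exact .cho h1 (ih h2)
  | parL _ _ _ ih =>
    rintro (⟨_ | _ | _ | ⟨_, h1, h2⟩⟩ | _ | _ | ⟨_, h1, h2⟩)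
    · exact .par _ (ih (.std h1)) (.std h2)
    · exact .par _ (ih h1) h2
  | parR _ _ _ ih =>
    rintro (⟨_ | _ | _ | ⟨_, h1, h2⟩⟩ | _ | _ | ⟨_, h1, h2⟩)
    · exact .par _ (.std h1) (ih (.std h2))
    · exact .par _ h1 (ih h2)
  | coo _ _ _ ih1 ih2 =>
    rintro (⟨_ | _ | _ | ⟨_, h1, h2⟩⟩ | _ | _ | ⟨_, h1, h2⟩)
    · exact .par _ (ih1 (.std h1)) (ih2 (.std h2))
    · exact .par _ (ih1 h1) (ih2 h2)

/-- Reachable terms are processes in the sense of the grammar. -/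
theorem Reachable.isProc {R : Term Act Key} (h : Reachable R) : IsProc R := by
  obtain ⟨P, hP, hR⟩ := h
  induction hR with
  | refl => exact .std hP
  | tail _ h ih => exact h.choose_spec.isProc ih

/-- The direction of a transition. -/
inductive Direction
  | fwd
  | bwd

/-- The transition relation: forward or backward transitions, according to the direction. -/
def Step (bar : Rate → Rate) : Direction → Term Act Key → Label Act Key → Term Act Key → Prop
  | .fwd => Fwd
  | .bwd => Bwd bar

/-- Transitions between reachable processes. A forward label and a backward label are kept apart
by the direction. -/
@[ext]
structure Transition (Act : Type u) (Key : Type v) (bar : Rate → Rate) where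
  dir : Direction
  src : Term Act Key
  label : Label Act Key
  tgt : Term Act Key
  src_reachable : Reachable src
  tgt_reachable : Reachable tgt
  step : Step bar dir src label tgt

/-- `IsInverse θ θ'`: `θ` is a forward transition and `θ'` is the corresponding backward
transition. The rate in the label of `θ'` is the one that the backward rules assign; see
`IsInverse.rate_eq`. -/
structure IsInverse {bar : Rate → Rate} (θ θ' : Transition Act Key bar) : Prop where
  dir : θ.dir = .fwd
  dir' : θ'.dir = .bwd
  src_eq : θ'.src = θ.tgt
  tgt_eq : θ'.tgt = θ.src
  act_eq : θ'.label.act = θ.label.act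
  key_eq : θ'.label.key = θ.label.key

/-- Process contexts: processes with a hole. -/
inductive Ctx (Act : Type u) (Key : Type v) : Type (max u v)
  | hole : Ctx Act Key
  | done (a : Act) (r : Rate) (i : Key) (C : Ctx Act Key) : Ctx Act Key
  | choL (C : Ctx Act Key) (S : Term Act Key) : Ctx Act Key
  | choR (R : Term Act Key) (C : Ctx Act Key) : Ctx Act Key
  | parL (L : Set Act) (C : Ctx Act Key) (S : Term Act Key) : Ctx Act Key
  | parR (L : Set Act) (R : Term Act Key) (C : Ctx Act Key) : Ctx Act Key

/-- The process obtained by replacing the hole of a context. -/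
def Ctx.fill : Ctx Act Key → Term Act Key → Term Act Key
  | .hole, R => R
  | .done a r i C, R => .done a r i (C.fill R)
  | .choL C S, R => .cho (C.fill R) S
  | .choR S C, R => .cho S (C.fill R)
  | .parL L C S, R => .par L (C.fill R) S
  | .parR L S C, R => .par L S (C.fill R)

/-- `DerivesFrom l₀ Q Q' C R l R'`: the forward transition from `R` to `R'` with label `l` has a
derivation by the forward rules in which the subterm `Q` at the hole of `C`, where `R` is
`C.fill Q`, makes the forward transition to `Q'` with label `l₀`. -/
inductive DerivesFrom (l₀ : Label Act Key) (Q Q' : Term Act Key) :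
    Ctx Act Key → Term Act Key → Label Act Key → Term Act Key → Prop
  | hole : Fwd Q l₀ Q' → DerivesFrom l₀ Q Q' .hole Q l₀ Q'
  | act₂ (a : Act) (r : Rate) (i : Key) {C : Ctx Act Key} {R R' : Term Act Key}
      {l : Label Act Key} :
      DerivesFrom l₀ Q Q' C R l R' → l.key ≠ i →
        DerivesFrom l₀ Q Q' (.done a r i C) (.done a r i R) l (.done a r i R')
  | choL {C : Ctx Act Key} {R R' S : Term Act Key} {l : Label Act Key} :
      DerivesFrom l₀ Q Q' C R l R' → Std S →
        DerivesFrom l₀ Q Q' (.choL C S) (.cho R S) l (.cho R' S)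
  | choR {C : Ctx Act Key} {R S S' : Term Act Key} {l : Label Act Key} :
      DerivesFrom l₀ Q Q' C S l S' → Std R →
        DerivesFrom l₀ Q Q' (.choR R C) (.cho R S) l (.cho R S')
  | parL {L : Set Act} {C : Ctx Act Key} {R R' S : Term Act Key} {l : Label Act Key} :
      DerivesFrom l₀ Q Q' C R l R' → l.act ∉ L → l.key ∉ keys S →
        DerivesFrom l₀ Q Q' (.parL L C S) (.par L R S) l (.par L R' S)
  | parR {L : Set Act} {C : Ctx Act Key} {R S S' : Term Act Key} {l : Label Act Key} :
      DerivesFrom l₀ Q Q' C S l S' → l.act ∉ L → l.key ∉ keys R →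
        DerivesFrom l₀ Q Q' (.parR L R C) (.par L R S) l (.par L R S')
  | cooL {L : Set Act} {C : Ctx Act Key} {R R' S S' : Term Act Key} {a : Act} {r s : Rate}
      {i : Key} :
      DerivesFrom l₀ Q Q' C R ⟨a, r, i⟩ R' → Fwd S ⟨a, s, i⟩ S' → a ∈ L →
        DerivesFrom l₀ Q Q' (.parL L C S) (.par L R S) ⟨a, r * s, i⟩ (.par L R' S')
  | cooR {L : Set Act} {C : Ctx Act Key} {R R' S S' : Term Act Key} {a : Act} {r s : Rate}
      {i : Key} :
      Fwd R ⟨a, r, i⟩ R' → DerivesFrom l₀ Q Q' C S ⟨a, s, i⟩ S' → a ∈ L →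
        DerivesFrom l₀ Q Q' (.parR L R C) (.par L R S) ⟨a, r * s, i⟩ (.par L R' S')

theorem DerivesFrom.src_eq {l₀ l : Label Act Key} {Q Q' R R' : Term Act Key} {C : Ctx Act Key}
    (h : DerivesFrom l₀ Q Q' C R l R') : R = C.fill Q := by
  induction h <;> simp_all [Ctx.fill]

theorem DerivesFrom.fwd {l₀ l : Label Act Key} {Q Q' R R' : Term Act Key} {C : Ctx Act Key}
    (h : DerivesFrom l₀ Q Q' C R l R') : Fwd R l R' := by
  induction h with
  | hole h => exact h
  | act₂ a r i _ h2 ih => exact .act₂ a r i ih h2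
  | choL _ h2 ih => exact .choL ih h2
  | choR _ h2 ih => exact .choR ih h2
  | parL _ h2 h3 ih => exact .parL ih h2 h3
  | parR _ h2 h3 ih => exact .parR ih h2 h3
  | cooL _ h2 h3 ih => exact .coo ih h2 h3
  | cooR h1 _ h3 ih => exact .coo h1 ih h3

section

variable {bar : Rate → Rate}

/-- A forward transition and a coinitial backward transition that undoes a cause of its key. -/
def CauseConflict (θ₁ θ₂ : Transition Act Key bar) : Prop :=
  θ₁.dir = .fwd ∧ θ₂.dir = .bwd ∧ θ₂.label.key ∈ cau θ₁.tgt θ₁.label.key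

/-- Two forward transitions that derive from the two branches of the same choice `P₁ + P₂` of
standard processes, where the common source is `C.fill (P₁ + P₂)`. -/
def ChoiceConflict (θ₁ θ₂ : Transition Act Key bar) : Prop :=
  θ₁.dir = .fwd ∧ θ₂.dir = .fwd ∧
    ∃ (C : Ctx Act Key) (P₁ P₂ S₁ S₂ : Term Act Key) (l₁ l₂ : Label Act Key),
      Std P₁ ∧ Std P₂ ∧ Fwd P₁ l₁ S₁ ∧ Fwd P₂ l₂ S₂ ∧
      DerivesFrom l₁ (.cho P₁ P₂) (.cho S₁ P₂) C θ₁.src θ₁.label θ₁.tgt ∧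
      DerivesFrom l₂ (.cho P₁ P₂) (.cho P₁ S₂) C θ₂.src θ₂.label θ₂.tgt

/-- Coinitial transitions in conflict, regardless of the order in which they are given. -/
def Conflict (θ₁ θ₂ : Transition Act Key bar) : Prop :=
  θ₁.src = θ₂.src ∧
    (CauseConflict θ₁ θ₂ ∨ CauseConflict θ₂ θ₁ ∨ ChoiceConflict θ₁ θ₂ ∨ ChoiceConflict θ₂ θ₁)

/-- Coinitial transitions that are not in conflict. -/
def Concurrent (θ₁ θ₂ : Transition Act Key bar) : Prop :=
  θ₁.src = θ₂.src ∧ ¬ Conflict θ₁ θ₂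

/-- `θ'` has the same label as `θ`, where a forward and a backward label are different. -/
def SameLabel (θ θ' : Transition Act Key bar) : Prop :=
  θ.dir = θ'.dir ∧ θ.label = θ'.label

/-- `IsPath R w S`: consecutive transitions of the list `w` are composable, and `w` leads from
`R` to `S`. -/
def IsPath : Term Act Key → List (Transition Act Key bar) → Term Act Key → Prop
  | R, [], S => R = S
  | R, θ :: w, S => θ.src = R ∧ IsPath θ.tgt w S

theorem IsPath.append {R S T : Term Act Key} {w w' : List (Transition Act Key bar)}
    (h : IsPath R w S) (h' : IsPath S w' T) : IsPath R (w ++ w') T := by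
  induction w generalizing R with
  | nil => cases h; exact h'
  | cons θ w ih => exact ⟨h.1, ih h.2⟩

end

/-- Computations: finite sequences of composable transitions between reachable processes. There
is one empty computation for each reachable process, its source and target. -/
@[ext]
structure Computation (Act : Type u) (Key : Type v) (bar : Rate → Rate) where
  src : Term Act Key
  steps : List (Transition Act Key bar)
  tgt : Term Act Key
  src_reachable : Reachable src
  isPath : IsPath src steps tgt

namespace Computation

variable {bar : Rate → Rate}

/-- The empty computation at a reachable process. -/
def empty (R : Term Act Key) (h : Reachable R) : Computation Act Key bar :=
  ⟨R, [], R, h, rfl⟩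

/-- The composition of two composable computations. -/
def comp (ω ω' : Computation Act Key bar) (h : ω.tgt = ω'.src) : Computation Act Key bar :=
  ⟨ω.src, ω.steps ++ ω'.steps, ω'.tgt, ω.src_reachable, ω.isPath.append (h ▸ ω'.isPath)⟩

/-- The computation made of two composable transitions. -/
def pair (θ θ' : Transition Act Key bar) (h : θ.tgt = θ'.src) : Computation Act Key bar :=
  ⟨θ.src, [θ, θ'], θ'.tgt, θ.src_reachable, rfl, h.symm, rfl⟩

/-- Same source. -/
def Coinitial (ω₁ ω₂ : Computation Act Key bar) : Prop := ω₁.src = ω₂.src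

/-- Same target. -/
def Cofinal (ω₁ ω₂ : Computation Act Key bar) : Prop := ω₁.tgt = ω₂.tgt

end Computation

/-- Causal equivalence: the least equivalence relation on computations that is closed under
composition, swaps concurrent transitions, and cancels a transition against its inverse. -/
inductive CausalEq {bar : Rate → Rate} :
    Computation Act Key bar → Computation Act Key bar → Prop
  | refl (ω : Computation Act Key bar) : CausalEq ω ω
  | symm {ω₁ ω₂ : Computation Act Key bar} : CausalEq ω₁ ω₂ → CausalEq ω₂ ω₁
  | trans {ω₁ ω₂ ω₃ : Computation Act Key bar} :
      CausalEq ω₁ ω₂ → CausalEq ω₂ ω₃ → CausalEq ω₁ ω₃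
  | comp {ω₁ ω₂ ω₁' ω₂' : Computation Act Key bar}
      (h₁ : ω₁.tgt = ω₁'.src) (h₂ : ω₂.tgt = ω₂'.src) :
      CausalEq ω₁ ω₂ → CausalEq ω₁' ω₂' → CausalEq (ω₁.comp ω₁' h₁) (ω₂.comp ω₂' h₂)
  | swap {θ₁ θ₂ θ₁' θ₂' : Transition Act Key bar}
      (h₁ : θ₁.tgt = θ₂'.src) (h₂ : θ₂.tgt = θ₁'.src) :
      Concurrent θ₁ θ₂ → SameLabel θ₁ θ₁' → SameLabel θ₂ θ₂' → θ₂'.tgt = θ₁'.tgt →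
        CausalEq (.pair θ₁ θ₂' h₁) (.pair θ₂ θ₁' h₂)
  | cancel {θ θ' : Transition Act Key bar} (h : IsInverse θ θ') :
      CausalEq (.pair θ θ' h.src_eq.symm) (.empty θ.src θ.src_reachable)
  | cancel' {θ θ' : Transition Act Key bar} (h : IsInverse θ θ') :
      CausalEq (.pair θ' θ h.tgt_eq) (.empty θ'.src θ'.src_reachable)

theorem Std.keys_eq {R : Term Act Key} (h : Std R) : keys R = ∅ := by
  induction h <;> simp_all [keys]

theorem Fwd.not_std {R S : Term Act Key} {l : Label Act Key} (h : Fwd R l S) : ¬ Std S := by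
  induction h <;> rintro ⟨⟩ <;> contradiction

theorem Fwd.key_mem {R S : Term Act Key} {l : Label Act Key} (h : Fwd R l S) :
    l.key ∈ keys S ∧ l.key ∉ keys R := by
  induction h <;> simp_all [keys, Std.keys_eq]

theorem Fwd.ne {R S : Term Act Key} {l : Label Act Key} (h : Fwd R l S) : R ≠ S := by
  rintro rfl
  exact h.key_mem.2 h.key_mem.1

theorem Bwd.ne {bar : Rate → Rate} {R S : Term Act Key} {l : Label Act Key}
    (h : Bwd bar R l S) : R ≠ S := by
  induction h <;> simp_all

theorem Fwd.bwd_rate_eq {bar : Rate → Rate} (hbar : ∀ r s, bar (r * s) = bar r * bar s)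
    {R S : Term Act Key} {l l' : Label Act Key} (h : Fwd R l S) (h' : Bwd bar S l' R) :
    l'.rate = bar l.rate := by
  induction h generalizing l' with
  | act₁ => cases h'; rfl
  | act₂ a r i _ _ ih => cases h' with | act₂ _ _ _ h _ => exact ih h
  | choL h0 h1 ih =>
    cases h' with
    | choL h _ => exact ih h
    | choR _ h => exact absurd h h0.not_std
  | choR h0 h1 ih =>
    cases h' with
    | choR h _ => exact ih h
    | choL _ h => exact absurd h h0.not_std
  | parL h0 h1 h2 ih =>
    cases h' with
    | parL h _ _ => exact ih h
    | parR _ _ _ => exact absurd rfl h0.ne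
    | coo _ h _ => exact absurd rfl h.ne
  | parR h0 h1 h2 ih =>
    cases h' with
    | parR h _ _ => exact ih h
    | parL _ _ _ => exact absurd rfl h0.ne
    | coo h _ _ => exact absurd rfl h.ne
  | coo h0 h1 h2 ih1 ih2 =>
    cases h' with
    | coo h h' _ =>
      have e1 := ih1 h
      have e2 := ih2 h'
      simp_all
    | parL _ _ _ => exact absurd rfl h1.ne
    | parR _ _ _ => exact absurd rfl h0.ne

/-- If `bar` is multiplicative, then the backward transition that corresponds to a forward
transition with label `<a, r>[i]` has the label `<a, bar r>[i]`. -/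
theorem IsInverse.rate_eq {bar : Rate → Rate} (hbar : ∀ r s, bar (r * s) = bar r * bar s)
    {θ θ' : Transition Act Key bar} (h : IsInverse θ θ') :
    θ'.label.rate = bar θ.label.rate := by
  have h1 := θ.step
  have h2 := θ'.step
  rw [h.dir] at h1
  rw [h.dir', h.src_eq, h.tgt_eq] at h2
  exact Fwd.bwd_rate_eq hbar h1 h2

end RMPC

namespace RMPC

universe u v

variable {Act : Type u} {Key : Type v} {bar : Rate → Rate}

/-! ### Transitions of terms -/

/-! Undoing is deterministic once the key is fixed (`Bwd.unique`), and two undos with different keys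
commute (`Bwd.diamond`). Both rest on the treatment of keys: the parallel rules for a single
component ask that the key be absent from the other component, and an undo never creates keys. No
diamond for forward transitions is needed: the swap axiom is only ever applied to two backward
transitions, which are never in conflict.

Since every transition has an inverse, computations modulo causal equivalence form a groupoid, and
common prefixes and suffixes cancel. From a standard process every computation is equivalent to a
forward one (`IsFwd.exists_append`). Indeed, let a forward step `θ` be followed by an undo `φ`.
Either `φ` is the inverse of `θ` and the two cancel, or the backward square on `φ` and the inverse
of `θ` rewrites `θ φ` into an undo followed by a forward step; the undo thus moves towards the
standard origin, where nothing can be undone, so it must cancel on the way.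

A forward loop is empty, because each forward step adds a key that no later forward step removes.
Hence a forward computation followed by the inverse of a cofinal one, both from a standard process,
is a loop equivalent to the empty computation, and the two are equivalent. For an arbitrary
reachable source, both computations are prefixed by a forward computation from a standard origin,
compared there, and the prefix is cancelled. -/

theorem Bwd.not_std {R S : Term Act Key} {l : Label Act Key} (h : Bwd bar R l S) : ¬ Std R := by
  induction h <;> rintro ⟨⟩ <;> contradiction

/-- This is what preserves the freshness conditions of the parallel rules when an undo in one
component is moved past an undo in the other. -/
theorem Bwd.keys_subset {R S : Term Act Key} {l : Label Act Key} (h : Bwd bar R l S) :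
    keys S ⊆ keys R := by
  induction h with
  | act₁ => simp [keys]
  | act₂ _ _ _ _ _ ih => exact Set.union_subset_union_right _ ih
  | choL _ _ ih => exact Set.union_subset_union_left _ ih
  | choR _ _ ih => exact Set.union_subset_union_right _ ih
  | parL _ _ _ ih => exact Set.union_subset_union_left _ ih
  | parR _ _ _ ih => exact Set.union_subset_union_right _ ih
  | coo _ _ _ ih₁ ih₂ => exact Set.union_subset_union ih₁ ih₂

theorem Bwd.key_mem {R S : Term Act Key} {l : Label Act Key} (h : Bwd bar R l S) :
    l.key ∈ keys R := by
  induction h <;> simp_all [keys]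

theorem Fwd.keys_subset {R S : Term Act Key} {l : Label Act Key} (h : Fwd R l S) :
    keys R ⊆ keys S := by
  induction h with
  | act₁ => simp [keys]
  | act₂ _ _ _ _ _ ih => exact Set.union_subset_union_right _ ih
  | choL _ _ ih => exact Set.union_subset_union_left _ ih
  | choR _ _ ih => exact Set.union_subset_union_right _ ih
  | parL _ _ _ ih => exact Set.union_subset_union_left _ ih
  | parR _ _ _ ih => exact Set.union_subset_union_right _ ih
  | coo _ _ _ ih₁ ih₂ => exact Set.union_subset_union ih₁ ih₂

/-- Every forward transition can be undone. -/
theorem Fwd.exists_bwd (bar : Rate → Rate) {R S : Term Act Key} {l : Label Act Key}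
    (h : Fwd R l S) : ∃ r, Bwd bar S ⟨l.act, r, l.key⟩ R := by
  induction h with
  | act₁ a r i h => exact ⟨_, .act₁ a r i h⟩
  | act₂ a r i _ hi ih => exact ih.imp fun _ h => .act₂ a r i h hi
  | choL _ hS ih => exact ih.imp fun _ h => .choL h hS
  | choR _ hR ih => exact ih.imp fun _ h => .choR h hR
  | parL _ ha hi ih => exact ih.imp fun _ h => .parL h ha hi
  | parR _ ha hi ih => exact ih.imp fun _ h => .parR h ha hi
  -- The rate is left existential because of this case: the backward rate is the product of the two
  -- backward rates, and `bar` need not be multiplicative.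
  | coo _ _ ha ih₁ ih₂ =>
    obtain ⟨_, h₁⟩ := ih₁
    obtain ⟨_, h₂⟩ := ih₂
    exact ⟨_, .coo h₁ h₂ ha⟩

/-- Every backward transition undoes a forward transition. -/
theorem Bwd.exists_fwd {R S : Term Act Key} {l : Label Act Key}
    (h : Bwd bar R l S) : ∃ r, Fwd S ⟨l.act, r, l.key⟩ R := by
  induction h with
  | act₁ a r i h => exact ⟨_, .act₁ a r i h⟩
  | act₂ a r i _ hi ih => exact ih.imp fun _ h => .act₂ a r i h hi
  | choL _ hS ih => exact ih.imp fun _ h => .choL h hS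
  | choR _ hR ih => exact ih.imp fun _ h => .choR h hR
  | parL _ ha hi ih => exact ih.imp fun _ h => .parL h ha hi
  | parR _ ha hi ih => exact ih.imp fun _ h => .parR h ha hi
  | coo _ _ ha ih₁ ih₂ =>
    obtain ⟨_, h₁⟩ := ih₁
    obtain ⟨_, h₂⟩ := ih₂
    exact ⟨_, .coo h₁ h₂ ha⟩

/-- A backward transition is determined by its source and its key. -/
theorem Bwd.unique {R S₁ S₂ : Term Act Key} {l₁ l₂ : Label Act Key}
    (h₁ : Bwd bar R l₁ S₁) (h₂ : Bwd bar R l₂ S₂) (hk : l₁.key = l₂.key) :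
    l₁ = l₂ ∧ S₁ = S₂ := by
  induction h₁ generalizing l₂ S₂ with
  | act₁ a r i h =>
    cases h₂ with
    | act₁ => exact ⟨rfl, rfl⟩
    | act₂ _ _ _ h' _ => exact absurd h h'.not_std
  | act₂ a r i h _ ih =>
    cases h₂ with
    | act₁ _ _ _ h' => exact absurd h' h.not_std
    | act₂ _ _ _ h' _ =>
      obtain ⟨rfl, rfl⟩ := ih h' hk
      exact ⟨rfl, rfl⟩
  | choL h _ ih =>
    cases h₂ with
    | choL h' _ =>
      obtain ⟨rfl, rfl⟩ := ih h' hk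
      exact ⟨rfl, rfl⟩
    | choR _ h' => exact absurd h' h.not_std
  | choR h _ ih =>
    cases h₂ with
    | choL _ h' => exact absurd h' h.not_std
    | choR h' _ =>
      obtain ⟨rfl, rfl⟩ := ih h' hk
      exact ⟨rfl, rfl⟩
  | parL h _ hi ih =>
    cases h₂ with
    | parL h' _ _ =>
      obtain ⟨rfl, rfl⟩ := ih h' hk
      exact ⟨rfl, rfl⟩
    -- Freshness of the key in the other component excludes every rule in which that component
    -- undoes the same key.
    | parR h' _ _ => exact absurd (hk ▸ h'.key_mem) hi
    | coo _ h' _ => exact absurd (hk ▸ h'.key_mem) hi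
  | parR h _ hi ih =>
    cases h₂ with
    | parL h' _ _ => exact absurd (hk ▸ h'.key_mem) hi
    | parR h' _ _ =>
      obtain ⟨rfl, rfl⟩ := ih h' hk
      exact ⟨rfl, rfl⟩
    | coo h' _ _ => exact absurd (hk ▸ h'.key_mem) hi
  | coo h h' _ ih ih' =>
    cases h₂ with
    | parL _ _ hi => exact absurd (hk ▸ h'.key_mem) hi
    | parR _ _ hi => exact absurd (hk ▸ h.key_mem) hi
    -- Both components of a cooperation carry its key, so both induction hypotheses apply; equal
    -- component labels then give the same product of rates.
    | coo k k' _ =>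
      obtain ⟨e, rfl⟩ := ih k hk
      obtain ⟨e', rfl⟩ := ih' k' hk
      cases e
      cases e'
      exact ⟨rfl, rfl⟩

/-- Coinitial backward transitions with different keys commute. -/
theorem Bwd.diamond {R S₁ S₂ : Term Act Key} {l₁ l₂ : Label Act Key}
    (h₁ : Bwd bar R l₁ S₁) (h₂ : Bwd bar R l₂ S₂) (hk : l₁.key ≠ l₂.key) :
    ∃ T, Bwd bar S₁ l₂ T ∧ Bwd bar S₂ l₁ T := by
  induction h₁ generalizing l₂ S₂ with
  | act₁ a r i h =>
    cases h₂ with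
    | act₁ => exact absurd rfl hk
    | act₂ _ _ _ h' _ => exact absurd h h'.not_std
  | act₂ a r i h hi ih =>
    cases h₂ with
    | act₁ _ _ _ h' => exact absurd h' h.not_std
    | act₂ _ _ _ h' hi' =>
      obtain ⟨T, k, k'⟩ := ih h' hk
      exact ⟨_, .act₂ _ _ _ k hi', .act₂ _ _ _ k' hi⟩
  | choL h hS ih =>
    cases h₂ with
    | choL h' _ =>
      obtain ⟨T, k, k'⟩ := ih h' hk
      exact ⟨_, .choL k hS, .choL k' hS⟩
    | choR _ h' => exact absurd h' h.not_std
  | choR h hR ih =>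
    cases h₂ with
    | choL _ h' => exact absurd h' h.not_std
    | choR h' _ =>
      obtain ⟨T, k, k'⟩ := ih h' hk
      exact ⟨_, .choR k hR, .choR k' hR⟩
  | parL h ha hi ih =>
    cases h₂ with
    | parL h' ha' hi' =>
      obtain ⟨T, k, k'⟩ := ih h' hk
      exact ⟨_, .parL k ha' hi', .parL k' ha hi⟩
    -- The undos lie in different components, so they commute at once; freshness survives because
    -- undoing only shrinks the key sets.
    | parR h' ha' hi' =>
      exact ⟨_, .parR h' ha' fun m => hi' (h.keys_subset m),
        .parL h ha fun m => hi (h'.keys_subset m)⟩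
    -- Only the left component takes part in both undos, so its square suffices; the right half of
    -- the cooperation is carried along unchanged.
    | coo h' h'' ha' =>
      obtain ⟨T, k, k'⟩ := ih h' hk
      exact ⟨_, .coo k h'' ha', .parL k' ha fun m => hi (h''.keys_subset m)⟩
  | parR h ha hi ih =>
    cases h₂ with
    | parL h' ha' hi' =>
      exact ⟨_, .parL h' ha' fun m => hi' (h.keys_subset m),
        .parR h ha fun m => hi (h'.keys_subset m)⟩
    | parR h' ha' hi' =>
      obtain ⟨T, k, k'⟩ := ih h' hk
      exact ⟨_, .parR k ha' hi', .parR k' ha hi⟩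
    | coo h' h'' ha' =>
      obtain ⟨T, k, k'⟩ := ih h'' hk
      exact ⟨_, .coo h' k ha', .parR k' ha fun m => hi (h'.keys_subset m)⟩
  | coo h h' ha ih ih' =>
    cases h₂ with
    | parL k ha' hi =>
      obtain ⟨T, m, m'⟩ := ih k hk
      exact ⟨_, .parL m ha' fun n => hi (h'.keys_subset n), .coo m' h' ha⟩
    | parR k ha' hi =>
      obtain ⟨T, m, m'⟩ := ih' k hk
      exact ⟨_, .parR m ha' fun n => hi (h.keys_subset n), .coo h m' ha⟩
    | coo k k' ha' =>
      obtain ⟨T, m, n⟩ := ih k hk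
      obtain ⟨T₂, m₂, n₂⟩ := ih' k' hk
      exact ⟨_, .coo m m₂ ha', .coo n n₂ ha⟩

/-- Undoing a step of a forward computation from a standard process leads to a process that
is also forward reachable from it. -/
theorem BwdStep.reflTransGen {P R S : Term Act Key} (hP : Std P)
    (hR : Relation.ReflTransGen FwdStep P R) (h : BwdStep bar R S) :
    Relation.ReflTransGen FwdStep P S := by
  induction hR generalizing S with
  | refl => exact absurd hP h.choose_spec.not_std
  | tail hT hTR ih =>
    obtain ⟨l, hl⟩ := h
    obtain ⟨m, hm⟩ := hTR
    obtain ⟨r, hb⟩ := hm.exists_bwd bar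
    by_cases hk : m.key = l.key
    -- Same key: the undo reverts exactly the last forward step.
    · obtain ⟨-, rfl⟩ := hb.unique hl hk
      exact hT
    -- Different keys: the undo is performed before the last forward step, reaching `U`, and that
    -- step is then redone from `U` to arrive at `S`.
    · obtain ⟨U, hU, hU'⟩ := hb.diamond hl hk
      obtain ⟨_, hf⟩ := hU'.exists_fwd
      exact (ih ⟨_, hU⟩).tail ⟨_, hf⟩

/-- A `Transition` must have reachable endpoints; this provides it for the fourth corner of a
backward diamond. -/
theorem Reachable.bwd {R S : Term Act Key} {l : Label Act Key} (hR : Reachable R)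
    (h : Bwd bar R l S) : Reachable S := by
  obtain ⟨P, hP, hPR⟩ := hR
  exact ⟨P, hP, BwdStep.reflTransGen hP hPR ⟨l, h⟩⟩

/-- Forward and backward transitions together reach, from a standard process, only what forward
transitions reach. -/
theorem Std.reflTransGen_fwdStep {P S : Term Act Key} (hP : Std P)
    (h : Relation.ReflTransGen (fun R R' => FwdStep R R' ∨ BwdStep bar R R') P S) :
    Relation.ReflTransGen FwdStep P S := by
  induction h with
  | refl => exact .refl
  | tail _ h ih =>
    obtain h | h := h
    · exact ih.tail h
    · exact BwdStep.reflTransGen hP ih h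

/-! ### Transitions between reachable processes -/

namespace Transition

theorem bwd_step {θ : Transition Act Key bar} (h : θ.dir = .bwd) :
    Bwd bar θ.src θ.label θ.tgt := by
  have := θ.step
  rwa [h] at this

theorem fwd_step {θ : Transition Act Key bar} (h : θ.dir = .fwd) :
    Fwd θ.src θ.label θ.tgt := by
  have := θ.step
  rwa [h] at this

theorem exists_inverse_of_fwd {θ : Transition Act Key bar} (h : θ.dir = .fwd) :
    ∃ θ', IsInverse θ θ' := by
  obtain ⟨r, hr⟩ := (fwd_step h).exists_bwd bar
  exact ⟨⟨.bwd, θ.tgt, _, θ.src, θ.tgt_reachable, θ.src_reachable, hr⟩,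
    h, rfl, rfl, rfl, rfl, rfl⟩

theorem exists_inverse_of_bwd {θ : Transition Act Key bar} (h : θ.dir = .bwd) :
    ∃ θ', IsInverse θ' θ := by
  obtain ⟨r, hr⟩ := (bwd_step h).exists_fwd
  exact ⟨⟨.fwd, θ.tgt, _, θ.src, θ.tgt_reachable, θ.src_reachable, hr⟩,
    rfl, h, rfl, rfl, rfl, rfl⟩

/-- In contrapositive form: distinct coinitial undos have distinct keys, which is the hypothesis of
`Bwd.diamond`. -/
theorem eq_of_key_eq {θ₁ θ₂ : Transition Act Key bar} (h₁ : θ₁.dir = .bwd) (h₂ : θ₂.dir = .bwd)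
    (hs : θ₁.src = θ₂.src) (hk : θ₁.label.key = θ₂.label.key) : θ₁ = θ₂ := by
  obtain ⟨e, e'⟩ := (bwd_step h₁).unique (hs ▸ bwd_step h₂) hk
  ext1
  exacts [h₁.trans h₂.symm, hs, e, e']

end Transition

open Transition

/-- Coinitial backward transitions are concurrent. -/
theorem concurrent_of_bwd {θ₁ θ₂ : Transition Act Key bar} (h₁ : θ₁.dir = .bwd)
    (h₂ : θ₂.dir = .bwd) (hs : θ₁.src = θ₂.src) : Concurrent θ₁ θ₂ := by
  refine ⟨hs, ?_⟩
  -- Each kind of conflict involves a forward transition.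
  rintro ⟨-, ⟨h, -⟩ | ⟨h, -⟩ | ⟨h, -⟩ | ⟨h, -⟩⟩ <;> simp_all

/-- Distinct coinitial backward transitions commute, up to causal equivalence. -/
theorem exists_square {θ₁ θ₂ : Transition Act Key bar} (h₁ : θ₁.dir = .bwd)
    (h₂ : θ₂.dir = .bwd) (hs : θ₁.src = θ₂.src) (hne : θ₁ ≠ θ₂) :
    ∃ (θ₁' θ₂' : Transition Act Key bar) (e₁ : θ₁.tgt = θ₂'.src) (e₂ : θ₂.tgt = θ₁'.src),
      SameLabel θ₁ θ₁' ∧ SameLabel θ₂ θ₂' ∧ θ₂'.tgt = θ₁'.tgt ∧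
        CausalEq (.pair θ₁ θ₂' e₁) (.pair θ₂ θ₁' e₂) := by
  obtain ⟨T, k₁, k₂⟩ := (bwd_step h₁).diamond (hs ▸ bwd_step h₂)
    fun hk => hne (eq_of_key_eq h₁ h₂ hs hk)
  have hT := θ₁.tgt_reachable.bwd k₁
  have s₁ : SameLabel θ₁ ⟨.bwd, θ₂.tgt, θ₁.label, T, θ₂.tgt_reachable, hT, k₂⟩ := ⟨h₁, rfl⟩
  have s₂ : SameLabel θ₂ ⟨.bwd, θ₁.tgt, θ₂.label, T, θ₁.tgt_reachable, hT, k₁⟩ := ⟨h₂, rfl⟩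
  exact ⟨_, _, rfl, rfl, s₁, s₂, rfl,
    .swap rfl rfl (concurrent_of_bwd h₁ h₂ hs) s₁ s₂ rfl⟩

/-! ### Causal equivalence of paths -/

/-- The easy half of causal consistency: every generating rule preserves both endpoints. -/
theorem CausalEq.coinitial_cofinal {ω₁ ω₂ : Computation Act Key bar} (h : CausalEq ω₁ ω₂) :
    ω₁.Coinitial ω₂ ∧ ω₁.Cofinal ω₂ := by
  induction h with
  | refl => exact ⟨rfl, rfl⟩
  | symm _ ih => exact ⟨ih.1.symm, ih.2.symm⟩
  | trans _ _ ih₁ ih₂ => exact ⟨ih₁.1.trans ih₂.1, ih₁.2.trans ih₂.2⟩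
  | comp _ _ _ _ ih₁ ih₂ => exact ⟨ih₁.1, ih₂.2⟩
  | swap _ _ hc _ _ ht => exact ⟨hc.1, ht⟩
  | cancel h => exact ⟨rfl, h.tgt_eq⟩
  | cancel' h => exact ⟨rfl, h.src_eq.symm⟩

/-- Two lists of transitions are causally equivalent computations from `R` to `S`. -/
def PathEq (R : Term Act Key) (w w' : List (Transition Act Key bar)) (S : Term Act Key) : Prop :=
  ∃ (hR : Reachable R) (h : IsPath R w S) (h' : IsPath R w' S),
    CausalEq ⟨R, w, S, hR, h⟩ ⟨R, w', S, hR, h'⟩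

theorem IsPath.reachable {R S : Term Act Key} {w : List (Transition Act Key bar)}
    (h : IsPath R w S) (hR : Reachable R) : Reachable S := by
  induction w generalizing R with
  | nil => exact h ▸ hR
  | cons θ w ih => exact ih h.2 θ.tgt_reachable

theorem IsPath.of_append_singleton {R S : Term Act Key} {w : List (Transition Act Key bar)}
    {θ : Transition Act Key bar} (h : IsPath R (w ++ [θ]) S) :
    IsPath R w θ.src ∧ θ.tgt = S := by
  induction w generalizing R with
  | nil => exact ⟨h.1.symm, h.2⟩
  | cons _ w ih => exact ⟨⟨h.1, (ih h.2).1⟩, (ih h.2).2⟩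

theorem Transition.isPath (θ : Transition Act Key bar) : IsPath θ.src [θ] θ.tgt := ⟨rfl, rfl⟩

namespace PathEq

variable {R S T : Term Act Key} {w w₁ w₂ w₃ w₁' w₂' : List (Transition Act Key bar)}

theorem refl (hR : Reachable R) (h : IsPath R w S) : PathEq R w w S := ⟨hR, h, h, .refl _⟩

theorem symm (h : PathEq R w₁ w₂ S) : PathEq R w₂ w₁ S := by
  obtain ⟨a, b, c, d⟩ := h
  exact ⟨a, c, b, d.symm⟩

theorem trans (h : PathEq R w₁ w₂ S) (h' : PathEq R w₂ w₃ S) : PathEq R w₁ w₃ S := by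
  obtain ⟨a, b, c, d⟩ := h
  obtain ⟨_, _, c', d'⟩ := h'
  exact ⟨a, b, c', d.trans d'⟩

theorem append (h : PathEq R w₁ w₂ S) (h' : PathEq S w₁' w₂' T) :
    PathEq R (w₁ ++ w₁') (w₂ ++ w₂') T := by
  obtain ⟨a, b, c, d⟩ := h
  obtain ⟨_, b', c', d'⟩ := h'
  exact ⟨a, b.append b', c.append c', .comp rfl rfl d d'⟩

theorem left (h : PathEq R w₁ w₂ S) : IsPath R w₁ S := h.2.1

theorem right (h : PathEq R w₁ w₂ S) : IsPath R w₂ S := h.2.2.1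

theorem append_left (hR : Reachable R) (h : IsPath R w S) (h' : PathEq S w₁ w₂ T) :
    PathEq R (w ++ w₁) (w ++ w₂) T :=
  (refl hR h).append h'

theorem append_right (h : PathEq R w₁ w₂ S) (h' : IsPath S w T) :
    PathEq R (w₁ ++ w) (w₂ ++ w) T :=
  h.append (refl (h.left.reachable h.1) h')

theorem of_tgt_eq (h : PathEq R w₁ w₂ S) (e : S = T) : PathEq R w₁ w₂ T := e ▸ h

end PathEq

/-- `PathEq` gives both lists the same endpoints, so that composition needs no separate matching
conditions; passing to it is legitimate because causal equivalence preserves source and target. -/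
theorem CausalEq.pathEq {ω₁ ω₂ : Computation Act Key bar} (h : CausalEq ω₁ ω₂) :
    PathEq ω₁.src ω₁.steps ω₂.steps ω₁.tgt := by
  have hc := h.coinitial_cofinal
  obtain ⟨R₁, w₁, S₁, hR₁, p₁⟩ := ω₁
  obtain ⟨R₂, w₂, S₂, hR₂, p₂⟩ := ω₂
  obtain ⟨rfl : R₁ = R₂, rfl : S₁ = S₂⟩ := hc
  exact ⟨hR₁, p₁, p₂, h⟩

theorem IsInverse.pathEq {θ θ' : Transition Act Key bar} (h : IsInverse θ θ') :
    PathEq θ.src [θ, θ'] [] θ.src :=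
  (CausalEq.cancel h).pathEq.of_tgt_eq h.tgt_eq

theorem IsInverse.pathEq' {θ θ' : Transition Act Key bar} (h : IsInverse θ θ') :
    PathEq θ'.src [θ', θ] [] θ'.src :=
  (CausalEq.cancel' h).pathEq.of_tgt_eq h.src_eq.symm

/-- Every transition has an inverse up to causal equivalence. -/
theorem Transition.exists_cancel (θ : Transition Act Key bar) :
    ∃ θ', PathEq θ.src [θ, θ'] [] θ.src ∧ PathEq θ.tgt [θ', θ] [] θ.tgt := by
  cases hd : θ.dir with
  | fwd =>
    obtain ⟨θ', h⟩ := exists_inverse_of_fwd hd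
    exact ⟨θ', h.pathEq, h.src_eq ▸ h.pathEq'⟩
  | bwd =>
    obtain ⟨θ', h⟩ := exists_inverse_of_bwd hd
    exact ⟨θ', h.pathEq', h.tgt_eq.symm ▸ h.pathEq⟩

/-- Every path has an inverse up to causal equivalence. -/
theorem IsPath.exists_cancel {R S : Term Act Key} {w : List (Transition Act Key bar)}
    (h : IsPath R w S) (hR : Reachable R) :
    ∃ w', IsPath S w' R ∧ PathEq R (w ++ w') [] R ∧ PathEq S (w' ++ w) [] S := by
  induction w generalizing R with
  | nil =>
    obtain rfl : R = S := h
    exact ⟨[], rfl, .refl hR rfl, .refl hR rfl⟩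
  | cons θ w ih =>
    obtain ⟨rfl, h⟩ := h
    obtain ⟨w', hw', h₁, h₂⟩ := ih h θ.tgt_reachable
    obtain ⟨θ', k₁, k₂⟩ := θ.exists_cancel
    have hθ' : IsPath θ.tgt [θ'] θ.src := k₁.left.2
    refine ⟨w' ++ [θ'], hw'.append hθ', ?_, ?_⟩
    · have := (PathEq.append_left hR θ.isPath (h₁.append_right hθ')).trans k₁
      simpa using this
    · have := (PathEq.append_left h₂.1 hw' (k₂.append_right h)).trans h₂
      simpa using this

/-- Cancellation in the groupoid of computations: compose on the left with an inverse of `w`. -/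
theorem PathEq.cancel_left {R S T : Term Act Key} {w w₁ w₂ : List (Transition Act Key bar)}
    (hw : IsPath R w S) (h₁ : IsPath S w₁ T) (h₂ : IsPath S w₂ T)
    (h : PathEq R (w ++ w₁) (w ++ w₂) T) : PathEq S w₁ w₂ T := by
  obtain ⟨w', hw', -, k⟩ := hw.exists_cancel h.1
  have := PathEq.append_left k.1 hw' h
  rw [← List.append_assoc, ← List.append_assoc] at this
  exact (k.append_right h₁).symm.trans (this.trans (k.append_right h₂))

/-- The mirror image, composing on the right with an inverse of `w`. -/
theorem PathEq.cancel_right {R S T : Term Act Key} {w w₁ w₂ : List (Transition Act Key bar)}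
    (hw : IsPath S w T) (h₁ : IsPath R w₁ S) (h₂ : IsPath R w₂ S)
    (h : PathEq R (w₁ ++ w) (w₂ ++ w) T) : PathEq R w₁ w₂ S := by
  obtain ⟨w', hw', k, -⟩ := hw.exists_cancel (h₁.reachable h.1)
  have := h.append_right hw'
  rw [List.append_assoc, List.append_assoc] at this
  simpa using
    (PathEq.append_left h.1 h₁ k).symm.trans (this.trans (PathEq.append_left h.1 h₂ k))

/-! ### Forward paths -/

/-- All transitions of the list are forward transitions. -/
def IsFwd (w : List (Transition Act Key bar)) : Prop := ∀ θ ∈ w, θ.dir = .fwd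

theorem exists_isFwd_path {P R : Term Act Key} (hP : Reachable P)
    (h : Relation.ReflTransGen FwdStep P R) :
    ∃ w : List (Transition Act Key bar), IsFwd w ∧ IsPath P w R := by
  induction h with
  | refl => exact ⟨[], by simp [IsFwd], rfl⟩
  | tail _ h ih =>
    obtain ⟨w, hw, hp⟩ := ih
    obtain ⟨l, hl⟩ := h
    have hR := hp.reachable hP
    have hS : Reachable _ := let ⟨Q, hQ, hQR⟩ := hR; ⟨Q, hQ, hQR.tail ⟨l, hl⟩⟩
    let θ : Transition Act Key bar := ⟨.fwd, _, l, _, hR, hS, hl⟩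
    refine ⟨w ++ [θ], ?_, hp.append θ.isPath⟩
    have hθ : θ.dir = .fwd := rfl
    simpa [IsFwd, or_imp, forall_and, hθ] using hw

theorem IsFwd.keys_subset {R S : Term Act Key} {w : List (Transition Act Key bar)}
    (hw : IsFwd w) (h : IsPath R w S) : keys R ⊆ keys S := by
  induction w generalizing R with
  | nil => exact (congrArg keys h).subset
  | cons θ w ih =>
    obtain ⟨rfl, h⟩ := h
    exact (fwd_step (hw θ (by simp))).keys_subset.trans
      (ih (fun ξ hξ => hw ξ (by simp [hξ])) h)

/-- There are no forward loops. -/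
theorem IsFwd.eq_nil {R : Term Act Key} {w : List (Transition Act Key bar)}
    (hw : IsFwd w) (h : IsPath R w R) : w = [] := by
  cases w with
  | nil => rfl
  | cons θ w =>
    obtain ⟨rfl, h⟩ := h
    -- The first step adds a key that was absent from its source, and the remaining forward steps
    -- keep it, so the path cannot return.
    have hθ := (fwd_step (hw θ (by simp))).key_mem
    exact absurd (IsFwd.keys_subset (fun ξ hξ => hw ξ (by simp [hξ])) h hθ.1) hθ.2

/-- A forward path from a standard process followed by a backward transition is causally
equivalent to a forward path. -/
theorem IsFwd.exists_append_bwd {P R : Term Act Key} {w : List (Transition Act Key bar)}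
    (hP : Std P) (hw : IsFwd w) (h : IsPath P w R) {φ : Transition Act Key bar}
    (hφ : φ.dir = .bwd) (hs : φ.src = R) :
    ∃ w', IsFwd w' ∧ PathEq P (w ++ [φ]) w' φ.tgt := by
  have hPr : Reachable P := ⟨P, hP, .refl⟩
  -- The undo `φ` is generalized because the induction hypothesis is applied to its residual after
  -- the last forward step has been commuted away.
  induction w using List.reverseRecOn generalizing R φ with
  | nil =>
    obtain rfl : P = R := h
    exact absurd (hs ▸ hP) (bwd_step hφ).not_std
  | append_singleton w θ ih =>
    have hw₀ : IsFwd w := fun ξ hξ => hw ξ (by simp [hξ])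
    have hθ : θ.dir = .fwd := hw θ (by simp)
    obtain ⟨hp, rfl⟩ := h.of_append_singleton
    obtain ⟨θ', hi⟩ := exists_inverse_of_fwd hθ
    -- The inverse `θ'` of the last forward step and `φ` are coinitial undos: they coincide and
    -- cancel, or they span a square.
    by_cases he : θ' = φ
    · subst he
      refine ⟨w, hw₀, ?_⟩
      have := (PathEq.append_left hPr hp hi.pathEq).of_tgt_eq hi.tgt_eq.symm
      simpa using this
    · obtain ⟨θ'', φ', e₁, e₂, s₁, s₂, e₃, hsq⟩ :=
        exists_square hi.dir' hφ (hi.src_eq.trans hs.symm) he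
      -- The residual `φ'` of `φ` starts where `w` ends, so the induction hypothesis absorbs it into
      -- a forward path.
      obtain ⟨w', hw', k⟩ := ih hw₀ hp (s₂.1 ▸ hφ) (e₁.symm.trans hi.tgt_eq)
      -- The forward step `ψ` redoes what `θ''` undoes, from the fourth corner of the square to the
      -- target of `φ`.
      obtain ⟨ψ, hψ⟩ := exists_inverse_of_bwd (s₁.1 ▸ hi.dir' : θ''.dir = .bwd)
      have hψt : ψ.tgt = φ.tgt := hψ.src_eq.symm.trans e₂.symm
      have hψs : φ'.tgt = ψ.src := e₃.trans hψ.tgt_eq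
      refine ⟨w' ++ [ψ], ?_, ?_⟩
      · simpa [IsFwd, or_imp, forall_and, hψ.dir] using hw'
      · have hψp : IsPath φ'.tgt [ψ] φ.tgt := ⟨hψs.symm, hψt⟩
        refine PathEq.trans ?_ (k.append_right hψp)
        -- The chain is `θ φ ≍ θ φ θ'' ψ ≍ θ θ' φ' ψ ≍ φ' ψ`: insert `θ'' ψ`, apply the square,
        -- cancel `θ θ'`.
        have hsq' : PathEq θ'.src [θ', φ'] [φ, θ''] φ'.tgt := hsq.pathEq
        have hφp : IsPath θ.tgt [φ] φ.tgt := ⟨hs, rfl⟩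
        have a₁ : PathEq θ.tgt [θ', φ', ψ] [φ, θ'', ψ] φ.tgt :=
          hi.src_eq ▸ hsq'.append_right hψp
        have a₂ : PathEq φ.tgt [θ'', ψ] [] φ.tgt :=
          (e₂ ▸ hψ.pathEq' : PathEq φ.tgt [θ'', ψ] [] θ''.src).of_tgt_eq e₂.symm
        have a₃ : PathEq θ.tgt [θ', φ', ψ] [φ] φ.tgt :=
          a₁.trans (PathEq.append_left θ.tgt_reachable hφp a₂)
        have a₄ : PathEq θ.src [θ, θ', φ', ψ] [θ, φ] φ.tgt :=
          PathEq.append_left θ.src_reachable θ.isPath a₃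
        have a₅ : PathEq θ.src [θ, θ', φ', ψ] [φ', ψ] φ.tgt :=
          hi.pathEq.append_right (w := [φ', ψ]) ⟨e₁.symm.trans hi.tgt_eq, hψp⟩
        simpa using PathEq.append_left hPr hp (a₄.symm.trans a₅)

/-- A forward path from a standard process followed by any path is causally equivalent to a
forward path. -/
theorem IsFwd.exists_append {P R S : Term Act Key} {w v : List (Transition Act Key bar)}
    (hP : Std P) (hw : IsFwd w) (h : IsPath P w R) (hv : IsPath R v S) :
    ∃ w', IsFwd w' ∧ PathEq P (w ++ v) w' S := by
  have hPr : Reachable P := ⟨P, hP, .refl⟩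
  induction v generalizing w R with
  | nil =>
    obtain rfl : R = S := hv
    exact ⟨w, hw, by simpa using PathEq.refl hPr h⟩
  | cons φ v ih =>
    obtain ⟨hs, hv⟩ := hv
    obtain ⟨w₁, hw₁, h₁⟩ : ∃ w₁, IsFwd w₁ ∧ PathEq P (w ++ [φ]) w₁ φ.tgt := by
      cases hd : φ.dir with
      | fwd =>
        refine ⟨w ++ [φ], ?_, .refl hPr (h.append ⟨hs, rfl⟩)⟩
        simpa [IsFwd, or_imp, forall_and, hd] using hw
      | bwd => exact hw.exists_append_bwd hP h hd hs
    obtain ⟨w₂, hw₂, h₂⟩ := ih hw₁ h₁.right hv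
    exact ⟨w₂, hw₂, by simpa using (h₁.append_right hv).trans h₂⟩

/-- Cofinal forward paths from a standard process are causally equivalent. -/
theorem IsFwd.pathEq {P S : Term Act Key} {w w' : List (Transition Act Key bar)}
    (hP : Std P) (hw : IsFwd w) (h : IsPath P w S) (h' : IsPath P w' S) :
    PathEq P w w' S := by
  have hPr : Reachable P := ⟨P, hP, .refl⟩
  -- With `v` an inverse of `w'`, the loop `w v` at `P` is equivalent to a forward loop, hence to
  -- the empty path, hence to `w' v`; then `v` is cancelled.
  obtain ⟨v, hv, h₁, h₂⟩ := h'.exists_cancel hPr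
  obtain ⟨u, hu, h₃⟩ := hw.exists_append hP h hv
  obtain rfl := hu.eq_nil h₃.right
  exact .cancel_right hv h h' (h₃.trans h₁.symm)

/-- Coinitial and cofinal paths are causally equivalent. -/
theorem IsPath.pathEq {R S : Term Act Key} {w w' : List (Transition Act Key bar)}
    (hR : Reachable R) (h : IsPath R w S) (h' : IsPath R w' S) : PathEq R w w' S := by
  obtain ⟨P, hP, hPR⟩ := id hR
  -- Forward normal forms are available only from a standard process, so the comparison takes place
  -- after prefixing `u`, which is cancelled at the end.
  obtain ⟨u, hu, hp⟩ := exists_isFwd_path (bar := bar) ⟨P, hP, .refl⟩ hPR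
  obtain ⟨v, hv, k⟩ := hu.exists_append hP hp h
  obtain ⟨v₂, hv₂, k₂⟩ := hu.exists_append hP hp h'
  exact .cancel_left hp h h' (k.trans ((hv.pathEq hP k.right k₂.right).trans k₂.symm))

/-- Causal consistency. -/
theorem causalEq_iff (ω₁ ω₂ : Computation Act Key bar) :
    CausalEq ω₁ ω₂ ↔ ω₁.Coinitial ω₂ ∧ ω₁.Cofinal ω₂ := by
  refine ⟨CausalEq.coinitial_cofinal, fun hc => ?_⟩
  obtain ⟨R₁, w₁, S₁, hR₁, p₁⟩ := ω₁
  obtain ⟨R₂, w₂, S₂, hR₂, p₂⟩ := ω₂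
  obtain ⟨rfl : R₁ = R₂, rfl : S₁ = S₂⟩ := hc
  exact (p₁.pathEq hR₁ p₂).2.2.2

end RMPC

theorem mainTheorem1 {Act : Type*} {Key : Type*} (bar : RMPC.Rate → RMPC.Rate) :
    -- causal consistency
    (∀ ω₁ ω₂ : RMPC.Computation Act Key bar,
      RMPC.CausalEq ω₁ ω₂ ↔ ω₁.Coinitial ω₂ ∧ ω₁.Cofinal ω₂) ∧
    -- rollbacks reach only states that forward computations can reach
    (∀ P S : RMPC.Term Act Key, RMPC.Std P →
      Relation.ReflTransGen (fun R R' => RMPC.FwdStep R R' ∨ RMPC.BwdStep bar R R') P S →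
        Relation.ReflTransGen RMPC.FwdStep P S) ∧
    -- concurrent undos may be done in any order
    (∀ θ₁ θ₂ : RMPC.Transition Act Key bar, θ₁.dir = .bwd → θ₂.dir = .bwd →
      θ₁.src = θ₂.src → θ₁ ≠ θ₂ →
        RMPC.Concurrent θ₁ θ₂ ∧
        ∃ (θ₁' θ₂' : RMPC.Transition Act Key bar)
          (h₁ : θ₁.tgt = θ₂'.src) (h₂ : θ₂.tgt = θ₁'.src),
          RMPC.SameLabel θ₁ θ₁' ∧ RMPC.SameLabel θ₂ θ₂' ∧ θ₂'.tgt = θ₁'.tgt ∧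
          RMPC.CausalEq (.pair θ₁ θ₂' h₁) (.pair θ₂ θ₁' h₂)) := by
  refine ⟨RMPC.causalEq_iff, fun P S hP h => hP.reflTransGen_fwdStep h, ?_⟩
  exact fun θ₁ θ₂ h₁ h₂ hs hne => ⟨RMPC.concurrent_of_bwd h₁ h₂ hs, RMPC.exists_square h₁ h₂ hs hne⟩
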